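/- All graphs are finite and simple. A graph $G$ has a $K_s$ minor if $V(G)$ contains $s$ pairwise disjoint sets, each inducing a connected (nonempty) subgraph of $G$, any two of which are joined by an edge of $G$. The star-arboricity of $G$ is the smallest integer $m\ge 0$ such that $E(G)$ can be decomposed into $m$ star forests, i.e. forests in which each component has diameter at most $2$. For an integer $s$, let $\ell(s)$ be the largest star-arboricity of a graph with no $K_s$ minor (with $\ell(s)=0$ for $s\le 0$, where there is no such graph). A spanning forest of $G$ is a maximal acyclic subgraph $T$ of $G$; the fundamental cut of $T$ with respect to an edge $f=xy$ of $T$ is the set of all edges of $G$ that join the component of $T-f$ containing $x$ to the component of $T-f$ containing $y$. **Theorem 1.5.** Let $t\ge 0$ be an integer. Then $\ell(t-1)$ is finite, and there exists an integer $k\le 16\,\ell(t-1)+1$ with the following property. If $G$ is a graph with no $K_t$ minor and $T$ is a spanning forest of $G$, then there exists a coloring $\varphi : E(G)\setminus E(T)\to\{1,\dots,k\}$ such that for each $f\in E(T)$ that is not a bridge of $G$, there exists a color $i\in\{1,\dots,k\}$ which occurs an odd number of times on the fundamental cut of $T$ with respect to $f$ (that is, the number of edges of color $i$ in this cut is odd).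 -/

import Mathlib

/-- `H` is a minor of `G`: there are pairwise disjoint, connected (in particular nonempty) branch
sets in `G`, one for each vertex of `H`, such that the branch sets of any two adjacent vertices
of `H` are joined by an edge of `G`. -/
def IsGraphMinor {W V : Type*} (H : SimpleGraph W) (G : SimpleGraph V) : Prop :=
  ∃ B : W → Set V,
    (∀ w, (G.induce (B w)).Connected) ∧
    (∀ w w', w ≠ w' → Disjoint (B w) (B w')) ∧
    (∀ w w', H.Adj w w' → ∃ x ∈ B w, ∃ y ∈ B w', G.Adj x y)

/-- `G` has the complete graph on `t` vertices as a minor. -/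
def HasCliqueMinor {V : Type*} (G : SimpleGraph V) (t : ℕ) : Prop :=
  IsGraphMinor (⊤ : SimpleGraph (Fin t)) G

/-- A star forest: a forest in which each component has diameter at most `2`. -/
def IsStarForest {V : Type*} (F : SimpleGraph V) : Prop :=
  F.IsAcyclic ∧ ∀ u v, F.Reachable u v → F.dist u v ≤ 2

/-- The edge set of `G` can be decomposed into (the edge sets of) `m` star forests. -/
def HasStarDecomposition {V : Type*} (G : SimpleGraph V) (m : ℕ) : Prop :=
  ∃ F : Fin m → SimpleGraph V,
    (∀ i, IsStarForest (F i)) ∧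
    (∀ i j, i ≠ j → Disjoint (F i).edgeSet (F j).edgeSet) ∧
    ⋃ i, (F i).edgeSet = G.edgeSet

/-- The star-arboricity of a (finite) graph. -/
noncomputable def starArboricity {V : Type*} (G : SimpleGraph V) : ℕ :=
  sInf {m | HasStarDecomposition G m}

/-- The star-arboricities of all finite graphs without a `K_s` minor (up to isomorphism, the
finite graphs are the graphs on the vertex sets `Fin n`). -/
def starArboricityValues (s : ℕ) : Set ℕ :=
  {a | ∃ (n : ℕ) (G : SimpleGraph (Fin n)), ¬ HasCliqueMinor G s ∧ starArboricity G = a}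

/-- The largest star-arboricity of a finite graph without a `K_s` minor. This is the maximum of
the set if the set is nonempty and bounded, and `0` if the set is empty. -/
noncomputable def maxStarArboricity (s : ℕ) : ℕ :=
  sSup (starArboricityValues s)

/-- A spanning forest of `G`: a maximal acyclic subgraph of `G`. -/
def IsSpanningForest {V : Type*} (G T : SimpleGraph V) : Prop :=
  Maximal (fun F : SimpleGraph V => F ≤ G ∧ F.IsAcyclic) T

/-- The fundamental cut of the forest `T` of `G` with respect to the edge `f = xy` of `T`: all
edges of `G` that join the component of `x` to the component of `y` in `T - f`. -/
def fundamentalCut {V : Type*} (G T : SimpleGraph V) (f : Sym2 V) : Set (Sym2 V) :=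
  {e | e ∈ G.edgeSet ∧ ∃ x y u v : V, f = s(x, y) ∧ e = s(u, v) ∧
    (T.deleteEdges {f}).Reachable x u ∧ (T.deleteEdges {f}).Reachable y v}

/-!
By Jaeger's eight-flow theorem there is a flow `φ` on `G` with values in `𝔽₂³` that is nonzero at
every edge that is not a bridge. Color the edges outside `T` by their value under `φ`. The values on
a cut sum to zero, and `f` is the only edge of `T` on its fundamental cut, so those on the edges of
this cut outside `T` sum to `φ f`. If `f` is not a bridge then this is nonzero, and some value
occurs an odd number of times. Hence eight colors always suffice. Moreover `ℓ (t - 1) ≥ 1` if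
`t > 3`, whereas for `t ≤ 3` a graph without a `K_t` minor has only bridges.

To construct the flow, let `A` be a set of vertices contracted to a single one and shrink `A` from
the whole vertex set to the empty set, maintaining a flow `ψ` over `𝔽₂` that vanishes at `A` and a
flow `θ` over `𝔽₂²` relative to `A` that do not vanish simultaneously off `A`. Take a minimal
nonempty set `B` off `A` that at most one edge leaves other than towards `A`; then `B` induces a
connected subgraph without bridges. If at most one edge joins `B` to `A`, it suffices to release one
vertex of `B`. Otherwise two edges join `B` to `A`, and a closed trail `c` in `B` passes through
their ends; release the vertices of `c`, let `ψ` be nonzero on `c`, and correct `θ` by sending flow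
along `c`.

The star-arboricity is bounded since a graph without a `K_s` minor is degenerate (Mader): color it
properly and greedily, orient its edges with bounded out-degree, and group the edges by the color of
the tail and the index of the edge among those leaving the tail.
-/

section Flow

open SimpleGraph

variable {V Γ : Type*} [AddCommGroup Γ] {G F : SimpleGraph V} {A : Set V} {φ : Sym2 V → Γ}

/-- The net flow of `φ` out of `u`. All flows are valued in groups of exponent two, where edges
need no orientation. -/
noncomputable def netFlow [Finite V] (u : V) : (Sym2 V → Γ) →+ Γ where
  toFun φ := ∑ᶠ e ∈ {e : Sym2 V | u ∈ e}, φ e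
  map_zero' := by simp
  map_add' _ _ := finsum_mem_add_distrib (Set.toFinite _)

theorem netFlow_apply [Finite V] (u : V) (φ : Sym2 V → Γ) :
    netFlow u φ = ∑ᶠ e ∈ {e : Sym2 V | u ∈ e}, φ e := rfl

/-- The flows of the graph obtained from `G` by contracting `A` to a single vertex, as functions on
all pairs: they vanish off `G` and are conserved at the vertices outside `A`. -/
def relFlow [Finite V] (G : SimpleGraph V) (Γ : Type*) [AddCommGroup Γ] (A : Set V) :
    AddSubgroup (Sym2 V → Γ) where
  carrier := {φ | (∀ e ∉ G.edgeSet, φ e = 0) ∧ ∀ u ∉ A, netFlow u φ = 0}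
  zero_mem' := ⟨fun _ _ => rfl, fun _ _ => map_zero _⟩
  add_mem' h₁ h₂ := ⟨fun e he => by simp [h₁.1 e he, h₂.1 e he],
    fun u hu => by simp [h₁.2 u hu, h₂.2 u hu]⟩
  neg_mem' h := ⟨fun e he => by simp [h.1 e he], fun u hu => by simp [h.2 u hu]⟩

theorem netFlow_single [Finite V] [DecidableEq V] {u v : V} (huv : u ≠ v) (a : V) (γ : Γ) :
    netFlow a (Pi.single s(u, v) γ) = (if a = u then γ else 0) + (if a = v then γ else 0) := by
  have hsum : netFlow a (Pi.single s(u, v) γ) = if a ∈ s(u, v) then γ else 0 := by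
    rw [netFlow_apply, finsum_mem_def, finsum_eq_single _ s(u, v)]
    · simp [Set.indicator_apply]
    · intro e he
      simp [Set.indicator_apply, he]
  rw [hsum]
  aesop

open scoped Classical in
/-- The flow sending `γ` along the walk `p`. -/
noncomputable def walkFlow {u v : V} (p : G.Walk u v) (γ : Γ) : Sym2 V → Γ :=
  fun e => p.edges.count e • γ

theorem walkFlow_of_notMem {u v : V} {p : G.Walk u v} {e : Sym2 V} (he : e ∉ p.edges) (γ : Γ) :
    walkFlow p γ e = 0 := by
  classical
  simp [walkFlow, List.count_eq_zero_of_not_mem he]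

theorem walkFlow_of_mem {u v : V} {p : G.Walk u v} (hp : p.IsTrail) {e : Sym2 V}
    (he : e ∈ p.edges) (γ : Γ) : walkFlow p γ e = γ := by
  classical
  simp [walkFlow, List.count_eq_one_of_mem hp.edges_nodup he]

section ExponentTwo

variable [Module (ZMod 2) Γ]

/-- An edge inside `S` contributes twice to the left side, that is nothing. -/
theorem finsum_mem_netFlow [Finite V] (hφ : ∀ e ∉ G.edgeSet, φ e = 0) (S : Set V) :
    ∑ᶠ u ∈ S, netFlow u φ = ∑ᶠ e ∈ (G.between S Sᶜ).edgeSet, φ e := by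
  classical
  have := Fintype.ofFinite V
  simp only [netFlow_apply, finsum_eq_if]
  simp only [finsum_eq_sum_of_fintype, Finset.ite_sum_zero]
  rw [Finset.sum_comm]
  refine Finset.sum_congr rfl fun e _ => ?_
  induction e with | h x y =>
  by_cases hxy : G.Adj x y
  · have hends (u : V) : (if u ∈ S then if u = x ∨ u = y then φ s(x, y) else 0 else 0) =
        (if u = x then if x ∈ S then φ s(x, y) else 0 else 0) +
          if u = y then if y ∈ S then φ s(x, y) else 0 else 0 := by
      have := hxy.ne
      aesop
    by_cases hx : x ∈ S <;> by_cases hy : y ∈ S <;>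
      simp [hends, hx, hy, hxy, between_adj, Finset.sum_add_distrib, ZModModule.add_self]
  · simp [hφ s(x, y) hxy, between_adj, hxy]

theorem finsum_cut_eq_zero [Finite V] (hφ : φ ∈ relFlow G Γ A) {S : Set V} (hSA : Disjoint S A) :
    ∑ᶠ e ∈ (G.between S Sᶜ).edgeSet, φ e = 0 := by
  rw [← finsum_mem_netFlow hφ.1]
  exact finsum_mem_eq_zero_of_forall_eq_zero fun u hu => hφ.2 u (Set.disjoint_left.1 hSA hu)

theorem apply_eq_of_cut_eq_pair [Finite V] (hφ : φ ∈ relFlow G Γ A) {S : Set V}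
    (hSA : Disjoint S A) {e f : Sym2 V} (hef : e ≠ f)
    (hcut : (G.between S Sᶜ).edgeSet = {e, f}) : φ e = φ f := by
  have hsum := finsum_cut_eq_zero hφ hSA
  rw [hcut, finsum_mem_pair hef] at hsum
  rwa [← sub_eq_zero, ZModModule.sub_eq_add]

theorem netFlow_eq_finsum_cut [Finite V] {S : Set V} (hSA : Disjoint S A) {x : V} (hx : x ∈ S)
    (hφ : φ ∈ relFlow G Γ (insert x A)) :
    netFlow x φ = ∑ᶠ e ∈ (G.between S Sᶜ).edgeSet, φ e := by
  rw [← finsum_mem_netFlow hφ.1, ← finsum_mem_singleton (a := x) (f := fun u => netFlow u φ)]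
  refine finsum_mem_inter_support_eq' _ _ _ fun u hu => ⟨fun hux => hux ▸ hx, fun huS => ?_⟩
  by_contra hux
  exact hu (hφ.2 u (by rintro (h | h); exacts [hux h, Set.disjoint_left.1 hSA huS h]))

open scoped Classical in
theorem netFlow_walkFlow [Finite V] {u v : V} (p : G.Walk u v) (a : V) (γ : Γ) :
    netFlow a (walkFlow p γ) = (if a = u then γ else 0) + (if a = v then γ else 0) := by
  induction p with
  | nil =>
    rw [ZModModule.add_self, ← map_zero (netFlow a)]
    congr 1
    ext e
    simp [walkFlow]
  | @cons u v w huv p ih =>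
    have hcons : walkFlow (p.cons huv) γ = walkFlow p γ + Pi.single s(u, v) γ := by
      ext e
      by_cases he : e = s(u, v)
      · simp [walkFlow, he, add_smul]
      · simp [walkFlow, he, Ne.symm he]
    rw [hcons, map_add, ih, netFlow_single huv.ne]
    calc _ = (if a = u then γ else 0) + (if a = w then γ else 0) +
          ((if a = v then γ else 0) + (if a = v then γ else 0)) := by abel
      _ = _ := by rw [ZModModule.add_self, add_zero]

theorem walkFlow_mem_relFlow [Finite V] {u v : V} (p : G.Walk u v) (γ : Γ)
    (huv : u = v ∨ u ∈ A ∧ v ∈ A) : walkFlow p γ ∈ relFlow G Γ A := by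
  classical
  refine ⟨fun e he => walkFlow_of_notMem (fun hp => he (p.edges_subset_edgeSet hp)) γ,
    fun a ha => ?_⟩
  rw [netFlow_walkFlow]
  obtain rfl | ⟨hu, hv⟩ := huv
  · exact ZModModule.add_self _
  · rw [if_neg (by rintro rfl; exact ha hu), if_neg (by rintro rfl; exact ha hv), add_zero]

/-- The excess of `φ` at each vertex can be drained into `A` along `F`. -/
theorem exists_relFlow_eq_off [Finite V] (hφ : ∀ e ∉ G.edgeSet, φ e = 0) (hFG : F ≤ G)
    (hF : ∀ u ∉ A, netFlow u φ ≠ 0 → ∃ a ∈ A, F.Reachable u a) :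
    ∃ φ' ∈ relFlow G Γ A, ∀ e ∉ F.edgeSet, φ' e = φ e := by
  classical
  have := Fintype.ofFinite V
  have hdrain (u : V) : ∃ χ : Sym2 V → Γ, (∀ e ∉ F.edgeSet, χ e = 0) ∧
      ∀ v ∉ A, netFlow v χ = if v = u then netFlow u φ else 0 := by
    by_cases hu : u ∉ A ∧ netFlow u φ ≠ 0
    · obtain ⟨a, ha, ⟨p⟩⟩ := hF u hu.1 hu.2
      refine ⟨walkFlow p (netFlow u φ),
        fun e he => walkFlow_of_notMem (fun hp => he (p.edges_subset_edgeSet hp)) _,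
        fun v hv => ?_⟩
      rw [netFlow_walkFlow, if_neg (c := v = a) (by rintro rfl; exact hv ha), add_zero]
    · refine ⟨0, fun _ _ => rfl, fun v hv => ?_⟩
      grind
  choose χ hχF hχ using hdrain
  refine ⟨φ + ∑ u, χ u, ⟨fun e he => ?_, fun v hv => ?_⟩, fun e he => ?_⟩
  · simp [hφ e he, fun u => hχF u e fun h => he (edgeSet_mono hFG h)]
  · simp [hχ _ v hv, ZModModule.add_self]
  · simp [fun u => hχF u e he]

end ExponentTwo
end Flow

section ClosedTrail

open SimpleGraph Walk

variable {V : Type*} {G : SimpleGraph V}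

theorem exists_isTrail_of_mem_support {x z v : V} {c : G.Walk x x} (hc : c.IsTrail)
    (hz : z ∈ c.support) (hv : v ∈ c.support) :
    ∃ r : G.Walk z v, r.IsTrail ∧ x ∈ r.support ∧ r.edges ⊆ c.edges := by
  classical
  have hc' := hc.rotate hz
  have hedges : (c.rotate z hz).edges ⊆ c.edges := fun e he => (c.rotate_edges z hz).mem_iff.1 he
  have hv' := (c.mem_support_rotate_iff z hz).2 hv
  have hx := (c.mem_support_rotate_iff z hz).2 c.start_mem_support
  rw [← take_spec _ hv', mem_support_append_iff] at hx
  obtain hx | hx := hx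
  · exact ⟨_, hc'.takeUntil hv', hx, fun e he => hedges (edges_takeUntil_subset_edges _ hv' he)⟩
  · refine ⟨_, (hc'.dropUntil hv').reverse, by simpa using hx, fun e he => ?_⟩
    rw [edges_reverse, List.mem_reverse] at he
    exact hedges (edges_dropUntil_subset_edges _ _ he)

/-- The trail is extended by an ear through the new edge `vw`, closed up along the half of the
trail that contains `x`. -/
theorem exists_isTrail_mem_support_of_adj (hG : ∀ e ∈ G.edgeSet, ¬ G.IsBridge e) {x v w : V}
    {c : G.Walk x x} (hc : c.IsTrail) (hv : v ∈ c.support) (hvw : G.Adj v w) :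
    ∃ c' : G.Walk x x, c'.IsTrail ∧ w ∈ c'.support := by
  classical
  by_cases hw : w ∈ c.support
  · exact ⟨c, hc, hw⟩
  obtain ⟨q, hq⟩ : ∃ q : (G.deleteEdges {s(v, w)}).Walk w v, q.IsPath := by
    have := hG s(v, w) hvw
    rw [isBridge_iff, not_not] at this
    exact this.symm.exists_isPath
  obtain ⟨z, hzc, hzq, hz⟩ := q.exists_mem_support_forall_mem_support_imp_eq c.support.toFinset
    ⟨v, by simp [hv]⟩
  simp only [List.mem_toFinset] at hzc hz
  obtain ⟨r, hr, hxr, hrc⟩ := exists_isTrail_of_mem_support hc hzc hv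
  have hle := G.deleteEdges_le {s(v, w)}
  let ear := (q.takeUntil z hzq).mapLe hle
  have hear_vw : s(v, w) ∉ ear.edges := fun h => by
    rw [edges_mapLe_eq_edges] at h
    exact (deleteEdges_adj.1 (adj_of_mem_edges _ h)).2 rfl
  have hear_c : List.Disjoint ear.edges c.edges := by
    intro e he hec
    induction e with | h a b =>
    rw [edges_mapLe_eq_edges] at he
    have ha := hz a (c.fst_mem_support_of_mem_edges hec) (fst_mem_support_of_mem_edges _ he)
    have hb := hz b (c.snd_mem_support_of_mem_edges hec) (snd_mem_support_of_mem_edges _ he)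
    exact (c.adj_of_mem_edges hec).ne (ha.trans hb.symm)
  have hearr : (ear.append r).IsTrail := (isTrail_append _ _).2
    ⟨(hq.isTrail.takeUntil hzq).mapLe hle, hr, fun e he her => hear_c he (hrc her)⟩
  have hvw' : s(v, w) ∉ (ear.append r).edges := fun h => by
    rw [edges_append, List.mem_append] at h
    exact h.elim hear_vw fun hr => hw (c.snd_mem_support_of_mem_edges (hrc hr))
  let c' := (ear.append r).cons hvw
  have hx : x ∈ c'.support := by simp [c', hxr]
  exact ⟨c'.rotate x hx, ((isTrail_cons _ _).2 ⟨hearr, hvw'⟩).rotate hx, by simp [c']⟩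

theorem exists_isTrail_mem_support (hG : ∀ e ∈ G.edgeSet, ¬ G.IsBridge e) {x y : V}
    (hxy : G.Reachable x y) : ∃ c : G.Walk x x, c.IsTrail ∧ y ∈ c.support := by
  rw [reachable_iff_reflTransGen] at hxy
  induction hxy with
  | refl => exact ⟨.nil, by simp, by simp⟩
  | tail _ hvw ih =>
    obtain ⟨c, hc, hv⟩ := ih
    exact exists_isTrail_mem_support_of_adj hG hc hv hvw

end ClosedTrail

section Exits

open SimpleGraph Walk

variable {V : Type*} {G : SimpleGraph V} {A B S : Set V}

/-- `B` is a nonempty set off `A` which at most one edge of `G` leaves other than towards `A`. The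
minimal such sets drive the construction of the flow. -/
structure HasAtMostOneExit (G : SimpleGraph V) (A B : Set V) : Prop where
  nonempty : B.Nonempty
  disjoint : Disjoint B A
  subsingleton : (G.between B (A ∪ B)ᶜ).edgeSet.Subsingleton

theorem exists_minimal_hasAtMostOneExit [Finite V] (G : SimpleGraph V) (hA : A ≠ Set.univ) :
    ∃ B, Minimal (HasAtMostOneExit G A) B := by
  have hcompl : HasAtMostOneExit G A Aᶜ := by
    refine ⟨Set.nonempty_compl.2 hA, disjoint_compl_left, ?_⟩
    rw [Set.union_compl_self, Set.compl_univ]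
    intro e he
    induction e with | h v w => simp [between_adj] at he
  obtain ⟨B, -, hB⟩ := exists_minimal_le_of_wellFoundedLT _ _ hcompl
  exact ⟨B, hB⟩

theorem not_subsingleton_between_of_no_exit (hB : Minimal (HasAtMostOneExit G A) B) (hSB : S ⊂ B)
    (hS : S.Nonempty) (hexit : ∀ v ∈ S, ∀ w ∉ A ∪ B, ¬ G.Adj v w) :
    ¬ (G.between S (B \ S)).edgeSet.Subsingleton := by
  intro hsub
  refine hSB.not_subset (hB.le_of_le ⟨hS, hB.prop.disjoint.mono_left hSB.subset, ?_⟩ hSB.subset)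
  have hmem {v w : V} (hvw : G.Adj v w) (hv : v ∈ S) (hw : w ∈ (A ∪ S)ᶜ) : w ∈ B \ S := by
    refine ⟨by_contra fun hwB => hexit v hv w ?_ hvw, fun hwS => hw (.inr hwS)⟩
    rintro (hwA | hwB')
    exacts [hw (.inl hwA), hwB hwB']
  exact hsub.anti (edgeSet_mono fun v w h => ⟨h.1, h.2.imp
    (fun ⟨hv, hw⟩ => ⟨hv, hmem h.1 hv hw⟩) (fun ⟨hv, hw⟩ => ⟨hmem h.1.symm hw hv, hw⟩)⟩)

theorem not_subsingleton_between_diff (hB : Minimal (HasAtMostOneExit G A) B) (hSB : S ⊂ B)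
    (hS : S.Nonempty) : ¬ (G.between S (B \ S)).edgeSet.Subsingleton := by
  by_cases hexit : ∀ v ∈ S, ∀ w ∉ A ∪ B, ¬ G.Adj v w
  · exact not_subsingleton_between_of_no_exit hB hSB hS hexit
  push Not at hexit
  obtain ⟨v, hv, w, hw, hvw⟩ := hexit
  have hdiff := not_subsingleton_between_of_no_exit (S := B \ S) hB
    (sdiff_lt hSB.subset hS.ne_empty) (Set.nonempty_of_ssubset hSB) fun v' hv' w' hw' hvw' => by
      have heq : s(v', w') = s(v, w) := hB.prop.subsingleton
        (between_adj.2 ⟨hvw', .inl ⟨hv'.1, hw'⟩⟩) (between_adj.2 ⟨hvw, .inl ⟨hSB.subset hv, hw⟩⟩)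
      obtain ⟨rfl, -⟩ | ⟨rfl, -⟩ := Sym2.eq_iff.1 heq
      · exact hv'.2 hv
      · exact hw (.inr hv'.1)
  rwa [Set.sdiff_sdiff_cancel_left hSB.subset, between_comm] at hdiff

theorem reachable_deleteEdges_between (hB : Minimal (HasAtMostOneExit G A) B) {x y : V}
    (hx : x ∈ B) (hy : y ∈ B) (e : Sym2 V) : ((G.between B B).deleteEdges {e}).Reachable x y := by
  by_contra hxy
  let S := {v ∈ B | ((G.between B B).deleteEdges {e}).Reachable x v}
  refine not_subsingleton_between_diff (S := S) hB
    ⟨fun v hv => hv.1, fun h => hxy (h hy).2⟩ ⟨x, hx, .rfl⟩ ?_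
  have hcross {v w : V} (hvw : G.Adj v w) (hv : v ∈ S) (hw : w ∈ B \ S) : s(v, w) = e := by
    by_contra hne
    refine hw.2 ⟨hw.1, hv.2.trans (Adj.reachable ?_)⟩
    exact deleteEdges_adj.2 ⟨⟨hvw, .inl ⟨hv.1, hw.1⟩⟩, hne⟩
  refine Set.subsingleton_of_subset_singleton (a := e) fun e' he' => ?_
  induction e' with | h v w =>
  obtain ⟨hvw, ⟨hv, hw⟩ | ⟨hv, hw⟩⟩ := he'
  · exact hcross hvw hv hw
  · exact Sym2.eq_swap.trans (hcross hvw.symm hw hv)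

theorem exists_isTrail_between (hB : Minimal (HasAtMostOneExit G A) B) {x y : V}
    (hx : x ∈ B) (hy : y ∈ B) :
    ∃ c : (G.between B B).Walk x x, c.IsTrail ∧ y ∈ c.support := by
  refine exists_isTrail_mem_support (fun e he => ?_)
    ((reachable_deleteEdges_between hB hx hy s(x, x)).mono (deleteEdges_le _))
  induction e with | h v w =>
  rw [isBridge_iff, not_not]
  obtain ⟨hv, hw⟩ : v ∈ B ∧ w ∈ B := by
    have := he.2
    tauto
  exact reachable_deleteEdges_between hB hv hw _

theorem mem_of_mem_support_between {x y v : V} (hx : x ∈ B) (p : (G.between B B).Walk x y)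
    (hv : v ∈ p.support) : v ∈ B := by
  induction p with
  | nil =>
    rw [support_nil, List.mem_singleton] at hv
    exact hv ▸ hx
  | cons h p ih =>
    obtain rfl | hv := List.mem_cons.1 ((support_cons _ _) ▸ hv)
    · exact hx
    · have := h.2
      exact ih (by tauto) hv

theorem exists_adj_ne_of_not_isBridge {v w : V} (h : ¬ G.IsBridge s(v, w)) (hv : v ∈ S)
    (hw : w ∉ S) : ∃ v' ∈ S, ∃ w' ∉ S, G.Adj v' w' ∧ s(v', w') ≠ s(v, w) := by
  rw [isBridge_iff, not_not] at h
  obtain ⟨p⟩ := h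
  obtain ⟨d, -, hd, hd'⟩ := p.exists_boundary_dart S hv hw
  obtain ⟨hadj, hne⟩ := deleteEdges_adj.1 d.adj
  exact ⟨d.fst, hd, d.snd, hd', hadj, hne⟩

theorem exists_cut_eq_pair (hG : ∀ e ∈ G.edgeSet, ¬ G.IsBridge e) (hB : HasAtMostOneExit G A B)
    {x a : V} (hx : x ∈ B) (ha : a ∈ A) (hxa : G.Adj x a)
    (hBA : ∀ y ∈ B, ∀ b ∈ A, G.Adj y b → s(y, b) = s(x, a)) :
    ∃ p ∈ B, ∃ q ∉ A ∪ B, G.Adj p q ∧ s(x, a) ≠ s(p, q) ∧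
      (G.between B Bᶜ).edgeSet = {s(x, a), s(p, q)} := by
  have haB : a ∉ B := fun haB => Set.disjoint_left.1 hB.disjoint haB ha
  have hexit {v w : V} (hv : v ∈ B) (hw : w ∉ B) (hvw : G.Adj v w) (hne : s(v, w) ≠ s(x, a)) :
      w ∉ A ∪ B := by
    rintro (hwA | hwB)
    exacts [hne (hBA v hv w hwA hvw), hw hwB]
  obtain ⟨p, hp, q, hq, hpq, hne⟩ := exists_adj_ne_of_not_isBridge (hG s(x, a) hxa) hx haB
  refine ⟨p, hp, q, hexit hp hq hpq hne, hpq, hne.symm, ?_⟩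
  have hcut {v w : V} (hv : v ∈ B) (hw : w ∉ B) (hvw : G.Adj v w) :
      s(v, w) ∈ ({s(x, a), s(p, q)} : Set (Sym2 V)) := by
    refine or_iff_not_imp_left.2 fun hne' => hB.subsingleton ?_ ?_
    exacts [between_adj.2 ⟨hvw, .inl ⟨hv, hexit hv hw hvw hne'⟩⟩,
      between_adj.2 ⟨hpq, .inl ⟨hp, hexit hp hq hpq hne⟩⟩]
  refine Set.Subset.antisymm (fun e he => ?_) ?_
  · induction e with | h v w =>
    obtain ⟨hvw, ⟨hv, hw⟩ | ⟨hv, hw⟩⟩ := he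
    exacts [hcut hv hw hvw, (Sym2.eq_swap (a := v)) ▸ hcut hw hv hvw.symm]
  · rintro e (rfl | rfl)
    exacts [between_adj.2 ⟨hxa, .inl ⟨hx, haB⟩⟩, between_adj.2 ⟨hpq, .inl ⟨hp, hq⟩⟩]

theorem isTrail_cons_concat {x y a b : V} (hBA : Disjoint B A) (ha : a ∈ A) (hb : b ∈ A)
    (hxa : G.Adj x a) (hyb : G.Adj y b) (hne : s(y, b) ≠ s(x, a)) {p : G.Walk x y}
    (hp : p.IsTrail) (hpB : ∀ v ∈ p.support, v ∈ B) :
    ((p.concat hyb).cons hxa.symm).IsTrail := by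
  have hnotMem {v w : V} (hw : w ∈ A) : s(v, w) ∉ p.edges := fun h =>
    Set.disjoint_left.1 hBA (hpB w (p.snd_mem_support_of_mem_edges h)) hw
  have hne' : s(a, x) ≠ s(y, b) := by
    rw [Sym2.eq_swap]
    exact hne.symm
  have hax : s(a, x) ∉ p.edges := by
    rw [Sym2.eq_swap]
    exact hnotMem ha
  rw [isTrail_def, edges_cons, edges_concat, List.concat_eq_append]
  simp [List.nodup_append', hp.edges_nodup, hne', hax, hnotMem hb]

end Exits

section EightFlow

open SimpleGraph Walk

variable {V : Type*} [Finite V] {G : SimpleGraph V} {A A' B : Set V} {ψ : Sym2 V → ZMod 2}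
  {θ : Sym2 V → ZMod 2 × ZMod 2}

/-- A flow `(ψ, θ)` with eight values that is nowhere zero on the edges not inside `A`, where `ψ`
is a flow of `G` vanishing at the edges that meet `A`, while `θ` is a flow relative to `A`. -/
structure IsRelEightFlow (G : SimpleGraph V) (A : Set V) (ψ : Sym2 V → ZMod 2)
    (θ : Sym2 V → ZMod 2 × ZMod 2) : Prop where
  left_mem : ψ ∈ relFlow G (ZMod 2) ∅
  right_mem : θ ∈ relFlow G (ZMod 2 × ZMod 2) A
  left_eq_zero : ∀ u ∈ A, ∀ v, ψ s(u, v) = 0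
  ne_zero : ∀ u ∉ A, ∀ v, G.Adj u v → ψ s(u, v) ≠ 0 ∨ θ s(u, v) ≠ 0

theorem isRelEightFlow_univ (G : SimpleGraph V) : IsRelEightFlow G Set.univ 0 0 :=
  ⟨zero_mem _, zero_mem _, fun _ _ _ => rfl, fun u hu => absurd (Set.mem_univ u) hu⟩

theorem IsRelEightFlow.of_no_edge (hG : ∀ e ∈ G.edgeSet, ¬ G.IsBridge e)
    (hB : HasAtMostOneExit G A B) (hBA : ∀ x ∈ B, ∀ a ∈ A, ¬ G.Adj x a) {x : V} (hx : x ∈ B)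
    (h : IsRelEightFlow G (insert x A) ψ θ) : IsRelEightFlow G A ψ θ := by
  have hexit {p q : V} (hp : p ∈ B) (hq : q ∉ B) (hpq : G.Adj p q) :
      s(p, q) ∈ (G.between B (A ∪ B)ᶜ).edgeSet := by
    refine between_adj.2 ⟨hpq, .inl ⟨hp, ?_⟩⟩
    rintro (hqA | hqB)
    exacts [hBA p hp q hqA hpq, hq hqB]
  have hcut {p q : V} (hp : p ∈ B) (hq : q ∉ B) : ¬ G.Adj p q := fun hpq => by
    obtain ⟨p', hp', q', hq', hpq', hne⟩ := exists_adj_ne_of_not_isBridge (hG s(p, q) hpq) hp hq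
    exact hne (hB.subsingleton (hexit hp' hq' hpq') (hexit hp hq hpq))
  have hx0 : netFlow x θ = 0 := by
    rw [netFlow_eq_finsum_cut hB.disjoint hx h.right_mem]
    refine finsum_mem_eq_zero_of_forall_eq_zero fun e he => ?_
    induction e with | h p q =>
    obtain ⟨hpq, ⟨hp, hq⟩ | ⟨hp, hq⟩⟩ := he
    exacts [absurd hpq (hcut hp hq), absurd hpq.symm (hcut hq hp)]
  refine ⟨h.left_mem, ⟨h.right_mem.1, fun u hu => ?_⟩, fun u hu => h.left_eq_zero u (.inr hu),
    fun u hu v huv => ?_⟩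
  · obtain rfl | hux := eq_or_ne u x
    · exact hx0
    · exact h.right_mem.2 u (by simp [hux, hu])
  · obtain rfl | hux := eq_or_ne u x
    · rw [Sym2.eq_swap]
      exact h.ne_zero v (by simpa [huv.ne'] using fun hv => hBA u hx v hv huv) u huv.symm
    · exact h.ne_zero u (by simp [hux, hu]) v huv

/-- At `xa` both flows take the value they have at the other edge of the cut around `B`. -/
theorem IsRelEightFlow.exists_of_single_edge (hG : ∀ e ∈ G.edgeSet, ¬ G.IsBridge e)
    (hB : HasAtMostOneExit G A B) {x a : V} (hx : x ∈ B) (ha : a ∈ A) (hxa : G.Adj x a)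
    (hBA : ∀ y ∈ B, ∀ b ∈ A, G.Adj y b → s(y, b) = s(x, a))
    (h : IsRelEightFlow G (insert x A) ψ θ) : ∃ θ', IsRelEightFlow G A ψ θ' := by
  obtain ⟨p, -, q, hq, hpq, hne, hcut⟩ := exists_cut_eq_pair hG hB hx ha hxa hBA
  obtain ⟨θ', hθ', hθθ'⟩ : ∃ θ' ∈ relFlow G _ A, ∀ e ∉ (edge x a).edgeSet, θ' e = θ e := by
    refine exists_relFlow_eq_off h.right_mem.1 ((edge_le_iff G).2 (.inr hxa)) fun u hu hu0 => ?_
    have hux : u = x := by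
      by_contra hux
      exact hu0 (h.right_mem.2 u (by simp [hux, hu]))
    exact ⟨a, ha, Adj.reachable (by simp [edge_adj, hux, hxa.ne])⟩
  rw [edgeSet_edge_of_ne hxa.ne] at hθθ'
  have hψ : ψ s(x, a) = ψ s(p, q) :=
    apply_eq_of_cut_eq_pair h.left_mem (Set.disjoint_empty B) hne hcut
  have hθ : θ' s(x, a) = θ s(p, q) :=
    (apply_eq_of_cut_eq_pair hθ' hB.disjoint hne hcut).trans (hθθ' _ hne.symm)
  have hne_zero {u v : V} (hu : u ∉ insert x A) (huv : G.Adj u v) :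
      ψ s(u, v) ≠ 0 ∨ θ' s(u, v) ≠ 0 := by
    rw [hθθ' _ (by aesop)]
    exact h.ne_zero u hu v huv
  refine ⟨θ', h.left_mem, hθ', fun u hu => h.left_eq_zero u (.inr hu), fun u hu v huv => ?_⟩
  obtain rfl | hux := eq_or_ne u x
  · by_cases hva : v = a
    · rw [hva, hψ, hθ, Sym2.eq_swap]
      exact h.ne_zero q (by aesop) p hpq.symm
    · rw [Sym2.eq_swap]
      refine hne_zero ?_ huv.symm
      rintro (hvu | hvA)
      exacts [huv.ne' hvu, hva (Sym2.congr_right.1 (hBA u hx v hvA huv))]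
  · exact hne_zero (by simp [hux, hu]) huv

/-- Every edge inside `A'` is given the value `γ`; the excess that this creates is drained into `A`
along `F`. -/
theorem exists_relFlow_eq_const {Γ : Type*} [AddCommGroup Γ] [Module (ZMod 2) Γ]
    {F : SimpleGraph V} {φ : Sym2 V → Γ} (hφ : φ ∈ relFlow G Γ A') (γ : Γ) (hFG : F ≤ G)
    (hF : ∀ w ∈ A', ∃ a ∈ A, F.Reachable w a) :
    ∃ φ' ∈ relFlow G Γ A, ∀ e ∈ G.edgeSet \ F.edgeSet,
      (∀ u ∈ e, u ∈ A') ∧ φ' e = γ ∨ (∃ u ∈ e, u ∉ A') ∧ φ' e = φ e := by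
  classical
  let φ₀ : Sym2 V → Γ := fun e => if e ∈ G.edgeSet ∧ ∀ u ∈ e, u ∈ A' then γ else φ e
  obtain ⟨φ', hφ', hφφ'⟩ : ∃ φ' ∈ relFlow G Γ A, ∀ e ∉ F.edgeSet, φ' e = φ₀ e := by
    refine exists_relFlow_eq_off (fun e he => by simp [φ₀, he, hφ.1]) hFG fun u _ hu0 => hF u ?_
    by_contra hu'
    refine hu0 ((finsum_mem_congr rfl fun e he => ?_).trans (hφ.2 u hu'))
    exact if_neg fun h => hu' (h.2 u he)
  refine ⟨φ', hφ', fun e he => ?_⟩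
  rw [hφφ' e he.2]
  by_cases h : ∀ u ∈ e, u ∈ A'
  · exact .inl ⟨h, if_pos ⟨he.1, h⟩⟩
  · exact .inr ⟨by simpa using h, if_neg fun hmem => h hmem.2⟩

/-- Sending a further flow along a trail `P` between contracted vertices makes the values at two
prescribed edges of `P` nonzero, since the group has more than two elements. -/
theorem exists_relFlow_ne_zero_of_isTrail (hθ : θ ∈ relFlow G (ZMod 2 × ZMod 2) A) {a b : V}
    (ha : a ∈ A) (hb : b ∈ A) {P : G.Walk a b} (hP : P.IsTrail) {e f : Sym2 V} (he : e ∈ P.edges)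
    (hf : f ∈ P.edges) :
    ∃ θ' ∈ relFlow G (ZMod 2 × ZMod 2) A, θ' e ≠ 0 ∧ θ' f ≠ 0 ∧ ∀ g ∉ P.edges, θ' g = θ g := by
  obtain ⟨γ, hγe, hγf⟩ : ∃ γ, θ e + γ ≠ 0 ∧ θ f + γ ≠ 0 := by
    generalize θ e = α
    generalize θ f = β
    revert α β
    decide
  refine ⟨θ + walkFlow P γ, add_mem hθ (walkFlow_mem_relFlow P γ (.inr ⟨ha, hb⟩)), ?_, ?_,
    fun g hg => ?_⟩
  · rwa [Pi.add_apply, walkFlow_of_mem hP he]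
  · rwa [Pi.add_apply, walkFlow_of_mem hP hf]
  · rw [Pi.add_apply, walkFlow_of_notMem hg, add_zero]

theorem exists_relFlow_ne_zero_of_walk (hθ : θ ∈ relFlow G (ZMod 2 × ZMod 2) A)
    (hBA : Disjoint B A) {x y a b : V} (ha : a ∈ A) (hb : b ∈ A) (hxa : G.Adj x a)
    (hyb : G.Adj y b) (hne : s(y, b) ≠ s(x, a)) {p : G.Walk x y} (hp : p.IsTrail)
    (hpB : ∀ v ∈ p.support, v ∈ B) :
    ∃ θ' ∈ relFlow G (ZMod 2 × ZMod 2) A, θ' s(x, a) ≠ 0 ∧ θ' s(y, b) ≠ 0 ∧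
      ∀ e ∉ p.edges, e ≠ s(x, a) → e ≠ s(y, b) → θ' e = θ e := by
  obtain ⟨θ', hθ', hθx, hθy, hθθ'⟩ := exists_relFlow_ne_zero_of_isTrail hθ ha hb
    (isTrail_cons_concat hBA ha hb hxa hyb hne hp hpB) (e := s(x, a)) (f := s(y, b))
    (by simp) (by simp)
  exact ⟨θ', hθ', hθx, hθy, fun e hep hex hey => hθθ' e (by simp [hep, hex, hey, Sym2.eq_swap])⟩

theorem exists_relFlow_of_closed_trail (hBA : Disjoint B A) {x y a b : V} (hx : x ∈ B)
    (ha : a ∈ A) (hb : b ∈ A) (hxa : G.Adj x a) (hyb : G.Adj y b) (hne : s(y, b) ≠ s(x, a))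
    {c : (G.between B B).Walk x x} (hc : c.IsTrail) (hy : y ∈ c.support)
    (hθ : θ ∈ relFlow G (ZMod 2 × ZMod 2) (A ∪ {v | v ∈ c.support})) :
    ∃ θ' ∈ relFlow G (ZMod 2 × ZMod 2) A, ∀ e ∈ G.edgeSet, e ∉ c.edges →
      θ' e ≠ 0 ∨ (∃ u ∈ e, u ∉ A ∪ {v | v ∈ c.support}) ∧ θ' e = θ e := by
  classical
  let F : SimpleGraph V := c.toSubgraph.spanningCoe ⊔ edge x a
  have hFG : F ≤ G := sup_le (c.toSubgraph.spanningCoe_le.trans between_le)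
    ((edge_le_iff G).2 (.inr hxa))
  have hF (e : Sym2 V) : e ∈ F.edgeSet ↔ e = s(x, a) ∨ e ∈ c.edges := by
    simp [F, edgeSet_edge_of_ne hxa.ne]
  have hreach (v : V) (hv : v ∈ c.support) : F.Reachable v a := by
    have hxv := (c.takeUntil v hv).transfer F fun e he =>
      (hF e).2 (.inr (edges_takeUntil_subset_edges _ hv he))
    exact hxv.reachable.symm.trans (Adj.reachable ((hF _).2 (.inl rfl)))
  obtain ⟨θ₁, hθ₁, hθθ₁⟩ := exists_relFlow_eq_const (A := A) hθ (1, 0) hFG fun v hv =>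
    hv.elim (fun hvA => ⟨v, hvA, .rfl⟩) fun hvc => ⟨a, ha, hreach v hvc⟩
  let p := (c.takeUntil y hy).mapLe between_le
  have hpB : ∀ v ∈ p.support, v ∈ B := fun v hv => by
    rw [support_mapLe_eq_support] at hv
    exact mem_of_mem_support_between hx _ hv
  obtain ⟨θ', hθ', hθx, hθy, hθ₁θ'⟩ := exists_relFlow_ne_zero_of_walk hθ₁ hBA ha hb hxa hyb hne
    ((hc.takeUntil hy).mapLe between_le) hpB
  refine ⟨θ', hθ', fun e heG hec => ?_⟩
  by_cases hex : e = s(x, a)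
  · exact .inl (hex ▸ hθx)
  by_cases hey : e = s(y, b)
  · exact .inl (hey ▸ hθy)
  have hep : e ∉ p.edges := fun h => by
    rw [edges_mapLe_eq_edges] at h
    exact hec (edges_takeUntil_subset_edges _ hy h)
  rw [hθ₁θ' e hep hex hey]
  obtain ⟨-, h⟩ | h := hθθ₁ e ⟨heG, by simp [hF, hex, hec]⟩
  · exact .inl (h ▸ by decide)
  · exact .inr h

theorem IsRelEightFlow.exists_of_closed_trail (hBA : Disjoint B A) {x y a b : V} (hx : x ∈ B)
    (ha : a ∈ A) (hb : b ∈ A) (hxa : G.Adj x a) (hyb : G.Adj y b) (hne : s(y, b) ≠ s(x, a))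
    {c : (G.between B B).Walk x x} (hc : c.IsTrail) (hy : y ∈ c.support)
    (h : IsRelEightFlow G (A ∪ {v | v ∈ c.support}) ψ θ) :
    ∃ ψ' θ', IsRelEightFlow G A ψ' θ' := by
  obtain ⟨θ', hθ', hθθ'⟩ :=
    exists_relFlow_of_closed_trail hBA hx ha hb hxa hyb hne hc hy h.right_mem
  let C := c.mapLe between_le
  have hC : C.edges = c.edges := edges_mapLe_eq_edges _ _
  refine ⟨ψ + walkFlow C 1, θ', add_mem h.left_mem (walkFlow_mem_relFlow C 1 (.inl rfl)), hθ',
    fun u hu v => ?_, fun u hu v huv => ?_⟩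
  · have hnotMem : s(u, v) ∉ C.edges := fun hmem => Set.disjoint_left.1 hBA
      (mem_of_mem_support_between hx c (c.fst_mem_support_of_mem_edges (hC ▸ hmem))) hu
    rw [Pi.add_apply, h.left_eq_zero u (.inl hu), walkFlow_of_notMem hnotMem, add_zero]
  · rw [Pi.add_apply]
    by_cases hmem : s(u, v) ∈ c.edges
    · left
      rw [h.left_eq_zero u (.inr (c.fst_mem_support_of_mem_edges hmem)), zero_add,
        walkFlow_of_mem (hc.mapLe between_le) (hC ▸ hmem)]
      decide
    · rw [walkFlow_of_notMem (hC ▸ hmem), add_zero]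
      obtain hne0 | ⟨⟨w, hwe, hw⟩, heq⟩ := hθθ' s(u, v) huv hmem
      · exact .inr hne0
      · rw [heq]
        obtain rfl | rfl := Sym2.mem_iff.1 hwe
        · exact h.ne_zero w hw v huv
        · rw [Sym2.eq_swap]
          exact h.ne_zero w hw u huv.symm

theorem exists_isRelEightFlow (hG : ∀ e ∈ G.edgeSet, ¬ G.IsBridge e) (A : Set V) :
    ∃ ψ θ, IsRelEightFlow G A ψ θ := by
  induction A using WellFoundedGT.induction with | ind A ih =>
  obtain rfl | hA := eq_or_ne A Set.univ
  · exact ⟨0, 0, isRelEightFlow_univ G⟩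
  obtain ⟨B, hB⟩ := exists_minimal_hasAtMostOneExit G hA
  have hBA := hB.prop.disjoint
  have hlt {x : V} (hx : x ∈ B) : A < insert x A :=
    Set.ssubset_insert (Set.disjoint_left.1 hBA hx)
  by_cases hnone : ∀ x ∈ B, ∀ a ∈ A, ¬ G.Adj x a
  · obtain ⟨x, hx⟩ := hB.prop.nonempty
    obtain ⟨ψ, θ, h⟩ := ih _ (hlt hx)
    exact ⟨ψ, θ, h.of_no_edge hG hB.prop hnone hx⟩
  push Not at hnone
  obtain ⟨x, hx, a, ha, hxa⟩ := hnone
  by_cases hone : ∀ y ∈ B, ∀ b ∈ A, G.Adj y b → s(y, b) = s(x, a)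
  · obtain ⟨ψ, θ, h⟩ := ih _ (hlt hx)
    exact ⟨ψ, h.exists_of_single_edge hG hB.prop hx ha hxa hone⟩
  push Not at hone
  obtain ⟨y, hy, b, hb, hyb, hne⟩ := hone
  obtain ⟨c, hc, hyc⟩ := exists_isTrail_between hB hx hy
  have hlt' : A < A ∪ {v | v ∈ c.support} := (hlt hx).trans_le
    (Set.insert_subset (.inr c.start_mem_support) Set.subset_union_left)
  obtain ⟨ψ, θ, h⟩ := ih _ hlt'
  exact h.exists_of_closed_trail hBA hx ha hb hxa hyb hne hc hyc

end EightFlow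

section OddColoring

open SimpleGraph

theorem exists_odd_ncard_of_finsum_ne_zero {α ι Γ : Type*} [AddCommGroup Γ] [Module (ZMod 2) Γ]
    {C : Set α} (hC : C.Finite) {κ : α → ι} {g : ι → Γ} (h : ∑ᶠ e ∈ C, g (κ e) ≠ 0) :
    ∃ i, Odd {e ∈ C | κ e = i}.ncard := by
  classical
  lift C to Finset α using hC
  contrapose! h
  rw [finsum_mem_coe_finset, Finset.sum_comp]
  refine Finset.sum_eq_zero fun i _ => ?_
  have hcard : {e ∈ (C : Set α) | κ e = i}.ncard = (C.filter (κ · = i)).card := by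
    rw [← Set.ncard_coe_finset, Finset.coe_filter]
    rfl
  obtain ⟨m, hm⟩ := Nat.not_odd_iff_even.1 (h i)
  rw [← hcard, hm, add_smul, ZModModule.add_self]

variable {V : Type*} {G T : SimpleGraph V}

theorem not_isBridge_deleteEdges_bridges (G : SimpleGraph V) :
    ∀ e ∈ (G.deleteEdges {e | G.IsBridge e}).edgeSet,
      ¬ (G.deleteEdges {e | G.IsBridge e}).IsBridge e := by
  intro e he hb
  obtain ⟨heG, hnb⟩ := (edgeSet_deleteEdges (G := G) _).subset he
  obtain ⟨w, c, hc, hec⟩ : ∃ (w : V) (c : G.Walk w w), c.IsCycle ∧ e ∈ c.edges := by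
    simpa [isBridge_iff_forall_cycle_notMem heG] using hnb
  have hcdel : ∀ e ∈ c.edges, e ∈ (G.deleteEdges {e | G.IsBridge e}).edgeSet := fun e he => by
    rw [edgeSet_deleteEdges]
    exact ⟨c.edges_subset_edgeSet he, fun hb => hb.notMem_edges_of_isCycle hc he⟩
  exact hb.notMem_edges_of_isCycle (hc.transfer hcdel) (by rwa [Walk.edges_transfer])

theorem comp_mem_relFlow {Γ Γ' : Type*} [AddCommGroup Γ] [AddCommGroup Γ'] [Finite V] {A : Set V}
    (g : Γ →+ Γ') {φ : Sym2 V → Γ} (hφ : φ ∈ relFlow G Γ A) : g ∘ φ ∈ relFlow G Γ' A := by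
  refine ⟨fun e he => by simp [hφ.1 e he], fun u hu => ?_⟩
  rw [← map_zero g, ← hφ.2 u hu]
  exact (g.map_finsum_mem _ (Set.toFinite _)).symm

theorem relFlow_mono {Γ : Type*} [AddCommGroup Γ] [Finite V] {A : Set V} {H : SimpleGraph V}
    (hHG : H ≤ G) : relFlow H Γ A ≤ relFlow G Γ A :=
  fun _ hφ => ⟨fun e he => hφ.1 e fun h => he (edgeSet_mono hHG h), hφ.2⟩

/-- Jaeger's eight-flow theorem. -/
theorem exists_eightFlow_ne_zero [Finite V] (G : SimpleGraph V) :
    ∃ φ ∈ relFlow G (ZMod 2 × ZMod 2 × ZMod 2) ∅, ∀ e ∈ G.edgeSet, ¬ G.IsBridge e → φ e ≠ 0 := by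
  obtain ⟨ψ, θ, h⟩ := exists_isRelEightFlow (not_isBridge_deleteEdges_bridges G) ∅
  refine ⟨_, relFlow_mono (G.deleteEdges_le _) (add_mem
    (comp_mem_relFlow (.inl _ _) h.left_mem) (comp_mem_relFlow (.inr _ _) h.right_mem)), ?_⟩
  intro e he hb
  induction e with | h u v =>
  have hne := h.ne_zero u (Set.notMem_empty u) v (deleteEdges_adj.2 ⟨he, hb⟩)
  simpa [-not_and, not_and_or] using hne

theorem reachable_deleteEdges_or {x v : V} (h : G.Reachable v x) (y : V) :
    (G.deleteEdges {s(x, y)}).Reachable x v ∨ (G.deleteEdges {s(x, y)}).Reachable y v := by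
  obtain ⟨p⟩ := h
  induction p with
  | nil => exact .inl .rfl
  | @cons a b x hab p ih =>
    by_cases hs : s(a, b) = s(x, y)
    · obtain ⟨rfl, -⟩ | ⟨rfl, -⟩ := Sym2.eq_iff.1 hs
      exacts [.inl .rfl, .inr .rfl]
    · have hba : (G.deleteEdges {s(x, y)}).Adj b a := (deleteEdges_adj.2 ⟨hab, hs⟩).symm
      exact ih.imp (·.trans hba.reachable) (·.trans hba.reachable)

theorem fundamentalCut_eq_edgeSet_between (hT : IsSpanningForest G T) {x y : V}
    (hxy : T.Adj x y) :
    fundamentalCut G T s(x, y) =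
      (G.between {w | (T.deleteEdges {s(x, y)}).Reachable x w}
        {w | (T.deleteEdges {s(x, y)}).Reachable x w}ᶜ).edgeSet := by
  set T' := T.deleteEdges {s(x, y)}
  have hsep : ¬ T'.Reachable x y :=
    isBridge_iff.1 (isAcyclic_iff_forall_isBridge.1 hT.prop.2 (T.mem_edgeSet.2 hxy))
  have hother {u v : V} (huv : G.Adj u v) (hu : T'.Reachable x u) (hv : ¬ T'.Reachable x v) :
      T'.Reachable y v := by
    have hvu : T.Reachable v u := by
      rw [G.reachable_eq_of_maximal_isAcyclic T hT]
      exact huv.symm.reachable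
    have hux : T.Reachable u x := (hu.mono (deleteEdges_le _)).symm
    exact (reachable_deleteEdges_or (hvu.trans hux) y).resolve_left hv
  ext e
  constructor
  · rintro ⟨he, x', y', u, v, hf, rfl, hu, hv⟩
    obtain ⟨rfl, rfl⟩ | ⟨rfl, rfl⟩ := Sym2.eq_iff.1 hf
    · exact ⟨he, .inl ⟨hu, fun h => hsep (h.trans hv.symm)⟩⟩
    · exact ⟨he, .inr ⟨fun h => hsep (h.trans hu.symm), hv⟩⟩
  · induction e with | h u v =>
    rintro ⟨huv, ⟨hu, hv⟩ | ⟨hu, hv⟩⟩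
    · exact ⟨huv, x, y, u, v, rfl, rfl, hu, hother huv hu hv⟩
    · exact ⟨huv, x, y, v, u, rfl, Sym2.eq_swap, hv, hother huv.symm hv hu⟩

theorem fundamentalCut_inter_edgeSet (hT : IsSpanningForest G T) {f : Sym2 V}
    (hf : f ∈ T.edgeSet) : fundamentalCut G T f ∩ T.edgeSet = {f} := by
  induction f with | h x y =>
  refine Set.Subset.antisymm ?_
    (Set.singleton_subset_iff.2 ⟨⟨hT.prop.1 hf, x, y, x, y, rfl, rfl, .rfl, .rfl⟩, hf⟩)
  rintro e ⟨hcut, heT⟩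
  by_contra hne
  rw [fundamentalCut_eq_edgeSet_between hT hf] at hcut
  induction e with | h u v =>
  have huv : (T.deleteEdges {s(x, y)}).Adj u v := deleteEdges_adj.2 ⟨heT, hne⟩
  obtain ⟨-, ⟨hu, hv⟩ | ⟨hu, hv⟩⟩ := hcut
  exacts [hv (hu.trans huv.reachable), hu (hv.trans huv.symm.reachable)]

theorem finsum_fundamentalCut_diff_eq [Finite V] {Γ : Type*} [AddCommGroup Γ] [Module (ZMod 2) Γ]
    {φ : Sym2 V → Γ} (hφ : φ ∈ relFlow G Γ ∅) (hT : IsSpanningForest G T) {f : Sym2 V}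
    (hf : f ∈ T.edgeSet) : ∑ᶠ e ∈ fundamentalCut G T f \ T.edgeSet, φ e = φ f := by
  have hcut : ∑ᶠ e ∈ fundamentalCut G T f, φ e = 0 := by
    induction f with | h x y =>
    rw [fundamentalCut_eq_edgeSet_between hT hf]
    exact finsum_cut_eq_zero hφ (Set.disjoint_empty _)
  rwa [← finsum_mem_inter_add_sdiff T.edgeSet (Set.toFinite _), fundamentalCut_inter_edgeSet hT hf,
    finsum_mem_singleton, ← ZModModule.sub_eq_add, sub_eq_zero, eq_comm] at hcut

theorem exists_odd_coloring [Finite V] (hT : IsSpanningForest G T) :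
    ∃ φ : ↥(G.edgeSet \ T.edgeSet) → Fin 8, ∀ f ∈ T.edgeSet, ¬ G.IsBridge f →
      ∃ i, Odd (Set.ncard {e : ↥(G.edgeSet \ T.edgeSet) |
        (e : Sym2 V) ∈ fundamentalCut G T f ∧ φ e = i}) := by
  obtain ⟨φ, hφ, hne⟩ := exists_eightFlow_ne_zero G
  let color : ZMod 2 × ZMod 2 × ZMod 2 ≃ Fin 8 := Fintype.equivFinOfCardEq rfl
  refine ⟨fun e => color (φ e), fun f hf hfb => ?_⟩
  let C : Set ↥(G.edgeSet \ T.edgeSet) := Subtype.val ⁻¹' fundamentalCut G T f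
  have himage : Subtype.val '' C = fundamentalCut G T f \ T.edgeSet := by
    rw [Subtype.image_preimage_coe]
    exact Set.ext fun e => ⟨fun h => ⟨h.2, h.1.2⟩, fun h => ⟨⟨h.1.1, h.2⟩, h.1⟩⟩
  have hsum : ∑ᶠ e ∈ C, φ e = φ f := by
    rw [← finsum_mem_image (f := φ) Subtype.val_injective.injOn, himage,
      finsum_fundamentalCut_diff_eq hφ hT hf]
  refine exists_odd_ncard_of_finsum_ne_zero (C := C) (g := color.symm) (Set.toFinite _) ?_
  simpa only [Equiv.symm_apply_apply, hsum] using hne f (edgeSet_mono hT.prop.1 hf) hfb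

end OddColoring

section CliqueMinors

open SimpleGraph

variable {V : Type*} {G : SimpleGraph V} {R S U : Set V} {r s t : ℕ}

/-- `G` has a `K_r` minor whose branch sets are contained in `S`. -/
def HasCliqueMinorIn (G : SimpleGraph V) (S : Set V) (r : ℕ) : Prop :=
  ∃ B : Fin r → Set V, (∀ i, (G.induce (B i)).Connected) ∧ (∀ i j, i ≠ j → Disjoint (B i) (B j)) ∧
    (∀ i j, i ≠ j → ∃ x ∈ B i, ∃ y ∈ B j, G.Adj x y) ∧ ∀ i, B i ⊆ S

theorem hasCliqueMinorIn_zero : HasCliqueMinorIn G S 0 :=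
  ⟨Fin.elim0, fun i => i.elim0, fun i => i.elim0, fun i => i.elim0, fun i => i.elim0⟩

theorem HasCliqueMinorIn.mono (h : HasCliqueMinorIn G R r) (hRS : R ⊆ S) :
    HasCliqueMinorIn G S r := by
  obtain ⟨B, hconn, hdisj, hadj, hB⟩ := h
  exact ⟨B, hconn, hdisj, hadj, fun i => (hB i).trans hRS⟩

theorem HasCliqueMinorIn.hasCliqueMinor (h : HasCliqueMinorIn G S r) : HasCliqueMinor G r := by
  obtain ⟨B, hconn, hdisj, hadj, -⟩ := h
  exact ⟨B, hconn, hdisj, hadj⟩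

theorem HasCliqueMinorIn.cone (h : HasCliqueMinorIn G R r) (hU : (G.induce U).Connected)
    (hUR : Disjoint U R) (hadj : ∀ v ∈ R, ∃ u ∈ U, G.Adj u v) :
    HasCliqueMinorIn G (U ∪ R) (r + 1) := by
  obtain ⟨B, hconn, hdisj, hBadj, hB⟩ := h
  have hUB (i : Fin r) : ∃ u ∈ U, ∃ y ∈ B i, G.Adj u y := by
    obtain ⟨y⟩ := (hconn i).nonempty
    obtain ⟨u, hu, huy⟩ := hadj y (hB i y.2)
    exact ⟨u, hu, y, y.2, huy⟩
  refine ⟨Fin.cons U B, Fin.cases hU hconn, ?_, ?_,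
    Fin.cases Set.subset_union_left fun i => (hB i).trans Set.subset_union_right⟩
  · refine Fin.cases (Fin.cases (absurd rfl) fun j _ => hUR.mono_right (hB j)) fun i =>
      Fin.cases (fun _ => (hUR.mono_right (hB i)).symm) fun j hij => ?_
    exact hdisj i j fun h => hij (congrArg Fin.succ h)
  · refine Fin.cases (Fin.cases (absurd rfl) fun j _ => hUB j) fun i =>
      Fin.cases (fun _ => ?_) fun j hij => ?_
    · obtain ⟨u, hu, y, hy, huy⟩ := hUB i
      exact ⟨y, hy, u, hu, huy.symm⟩
    · exact hBadj i j fun h => hij (congrArg Fin.succ h)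

theorem HasCliqueMinor.anti (h : HasCliqueMinor G t) (hst : s ≤ t) : HasCliqueMinor G s := by
  obtain ⟨B, hconn, hdisj, hadj⟩ := h
  have hinj := Fin.castLE_injective hst
  exact ⟨fun i => B (i.castLE hst), fun i => hconn _, fun i j hij => hdisj _ _ (hinj.ne hij),
    fun i j hij => hadj _ _ (hinj.ne hij)⟩

theorem HasCliqueMinor.le_card [Finite V] (h : HasCliqueMinor G t) : t ≤ Nat.card V := by
  obtain ⟨B, hconn, hdisj, -⟩ := h
  choose x hx using fun i => Set.nonempty_coe_sort.1 (hconn i).nonempty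
  have hinj : Function.Injective x := fun i j hij => by
    by_contra hne
    exact Set.disjoint_left.1 (hdisj i j hne) (hx i) (hij ▸ hx j)
  simpa using Nat.card_le_card_of_injective x hinj

theorem connected_induce_singleton (G : SimpleGraph V) (v : V) : (G.induce {v}).Connected := by
  rw [induce_singleton_eq_top]
  exact connected_top

/-- The three branch sets are the two ends of the edge and the interior of a path joining them. -/
theorem hasCliqueMinor_three_of_not_isBridge {u v : V} (huv : G.Adj u v)
    (h : ¬ G.IsBridge s(u, v)) : HasCliqueMinor G 3 := by
  classical
  rw [isBridge_iff, not_not] at h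
  obtain ⟨p, hp⟩ := h.exists_isPath
  have hle := G.deleteEdges_le {s(u, v)}
  cases p with
  | nil => exact absurd rfl huv.ne
  | @cons _ w _ huw p =>
    have hnil : ¬ p.Nil := fun hnil => by
      obtain rfl := hnil.eq
      exact (deleteEdges_adj.1 huw).2 rfl
    rw [Walk.cons_isPath_iff] at hp
    have hsupp := Walk.support_dropLast_concat hnil
    have hv : v ∉ p.dropLast.support := by
      have hnodup := hp.1.support_nodup
      rw [← hsupp, List.nodup_append] at hnodup
      exact fun hv => hnodup.2.2 v hv v (List.mem_singleton_self v) rfl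
    have hu : u ∉ p.dropLast.support := fun hu => hp.2 (hsupp ▸ List.mem_append_left _ hu)
    have hconn := (p.dropLast.mapLe hle).connected_induce_support
    rw [Walk.support_mapLe_eq_support] at hconn
    have hedge : HasCliqueMinorIn G ({u} ∪ ({v} ∪ ∅)) 2 :=
      (hasCliqueMinorIn_zero.cone (connected_induce_singleton G v) (by simp) (by simp)).cone
        (connected_induce_singleton G u) (by simpa using huv.ne) (by simpa using huv)
    refine (hedge.cone hconn ?_ ?_).hasCliqueMinor
    · simp [hu, hv]
    · have hw : ∃ x ∈ p.dropLast.support, G.Adj x u :=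
        ⟨w, p.dropLast.start_mem_support, hle huw.symm⟩
      have hz : ∃ x ∈ p.dropLast.support, G.Adj x v :=
        ⟨_, p.dropLast.end_mem_support, hle (p.adj_penultimate hnil)⟩
      simpa using ⟨hz, hw⟩

end CliqueMinors

section Density

open SimpleGraph Finset

variable {V : Type*} {G : SimpleGraph V} {S U : Finset V} {v : V}

open scoped Classical in
/-- The degree of `v` in the subgraph of `G` induced by `S`, also for `v` outside `S`. -/
noncomputable def degreeIn (G : SimpleGraph V) (S : Finset V) (v : V) : ℕ :=
  #{w ∈ S | G.Adj v w}

/-- The sum of the degrees, that is twice the number of edges, of the subgraph of `G` induced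
by `S`. -/
noncomputable def degreeSum (G : SimpleGraph V) (S : Finset V) : ℕ :=
  ∑ v ∈ S, degreeIn G S v

open scoped Classical in
/-- The neighborhood of the set `U` in `S \ U`. -/
noncomputable def outerNeighbors (G : SimpleGraph V) (S U : Finset V) : Finset V :=
  {v ∈ S \ U | ∃ u ∈ U, G.Adj u v}

open scoped Classical in
/-- The sum of the degrees of the simple graph obtained from the subgraph induced by `S` by
contracting `U` to a single vertex. -/
noncomputable def contractedDegreeSum (G : SimpleGraph V) (S U : Finset V) : ℕ :=
  degreeSum G (S \ U) + 2 * #(outerNeighbors G S U)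

theorem degreeSum_erase [DecidableEq V] (hv : v ∈ S) :
    degreeSum G S = degreeSum G (S.erase v) + 2 * degreeIn G S v := by
  classical
  have hdeg (w : V) : degreeIn G S w = degreeIn G (S.erase v) w + if G.Adj v w then 1 else 0 := by
    simp only [degreeIn, card_filter, G.adj_comm v w]
    exact (sum_erase_add S _ hv).symm
  have hnbrs : ∑ w ∈ S.erase v, (if G.Adj v w then 1 else 0) = degreeIn G S v := by
    rw [hdeg v, if_neg (G.loopless.irrefl v), add_zero, degreeIn, card_filter]
  calc degreeSum G S = ∑ w ∈ S.erase v, degreeIn G S w + degreeIn G S v :=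
        (sum_erase_add S _ hv).symm
    _ = degreeSum G (S.erase v) + degreeIn G S v + degreeIn G S v := by
        rw [sum_congr rfl fun w _ => hdeg w, sum_add_distrib, hnbrs, degreeSum]
    _ = _ := by ring

theorem contractedDegreeSum_singleton (hv : v ∈ S) :
    contractedDegreeSum G S {v} = degreeSum G S := by
  classical
  have hnbrs : outerNeighbors G S {v} = {w ∈ S | G.Adj v w} := by
    ext w
    have : G.Adj v w → w ≠ v := Adj.ne'
    simp only [outerNeighbors, mem_filter, mem_sdiff, mem_singleton, exists_eq_left]
    tauto
  rw [degreeSum_erase hv, contractedDegreeSum, sdiff_singleton_eq_erase, hnbrs, degreeIn]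

open scoped Classical in
theorem contractedDegreeSum_insert (hv : v ∈ outerNeighbors G S U) :
    contractedDegreeSum G S U =
      contractedDegreeSum G S (insert v U) + 2 * (degreeIn G (outerNeighbors G S U) v + 1) := by
  set N := outerNeighbors G S U with hN
  have hvR : v ∈ S \ U := (mem_filter.1 hv).1
  have hloop (w : V) : G.Adj v w → w ≠ v := Adj.ne'
  have hunion : outerNeighbors G S (insert v U) = N.erase v ∪ {w ∈ S \ U | G.Adj v w} := by
    ext w
    simp only [hN, outerNeighbors, mem_filter, mem_sdiff, mem_insert, mem_union, mem_erase,
      exists_eq_or_imp]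
    grind
  have hinter : N.erase v ∩ {w ∈ S \ U | G.Adj v w} = {w ∈ N | G.Adj v w} := by
    ext w
    simp only [hN, outerNeighbors, mem_filter, mem_inter, mem_erase]
    grind
  have hcard := card_union_add_card_inter (N.erase v) {w ∈ S \ U | G.Adj v w}
  rw [← hunion, hinter, ← degreeIn, ← degreeIn] at hcard
  have herase := card_erase_add_one hv
  rw [contractedDegreeSum, contractedDegreeSum, degreeSum_erase hvR, sdiff_insert, ← hN]
  omega

open scoped Classical in
/-- Contract a connected set `U` that is maximal subject to the contracted graph still having
average degree at least `2 * m`: contracting one more vertex then loses many edges, all of which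
come from triangles. -/
theorem exists_maximal_contraction {m : ℕ} (hS : S.Nonempty) (h : 2 * m * #S ≤ degreeSum G S) :
    ∃ U ⊆ S, (G.induce (U : Set V)).Connected ∧
      2 * m * (#(S \ U) + 1) ≤ contractedDegreeSum G S U ∧
      ∀ v ∈ outerNeighbors G S U, m ≤ degreeIn G (outerNeighbors G S U) v := by
  let Good (U : Finset V) : Prop := U ⊆ S ∧ (G.induce (U : Set V)).Connected ∧
    2 * m * (#(S \ U) + 1) ≤ contractedDegreeSum G S U
  obtain ⟨x, hx⟩ := hS
  have hgood : Good {x} := by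
    refine ⟨by simpa using hx, by rw [coe_singleton]; exact connected_induce_singleton G x, ?_⟩
    rwa [contractedDegreeSum_singleton hx, sdiff_singleton_eq_erase, card_erase_add_one hx]
  obtain ⟨U, hU⟩ := (S.powerset.finite_toSet.subset
    fun U (hU : Good U) => by simpa using hU.1).exists_maximal ⟨_, hgood⟩
  obtain ⟨hUS, hUconn, hUsum⟩ := hU.prop
  refine ⟨U, hUS, hUconn, hUsum, fun v hv => ?_⟩
  obtain ⟨hvR, u, hu, huv⟩ := mem_filter.1 hv
  obtain ⟨hvS, hvU⟩ := mem_sdiff.1 hvR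
  have hconn : (G.induce ((insert v U : Finset V) : Set V)).Connected := by
    rw [coe_insert, Set.insert_eq, Set.union_comm]
    exact connected_induce_union hUconn.preconnected
      (connected_induce_singleton G v).preconnected hu rfl huv
  have hlt : contractedDegreeSum G S (insert v U) < 2 * m * #(S \ U) := by
    by_contra! hle
    refine hvU (hU.le_of_ge ⟨insert_subset hvS hUS, hconn, ?_⟩ (subset_insert v U)
      (mem_insert_self v U))
    rwa [sdiff_insert, card_erase_add_one hvR]
  rw [contractedDegreeSum_insert hv, mul_add, mul_one] at hUsum
  omega

theorem exists_connected_dense_neighbors {m : ℕ} (hm : 0 < m) (hS : S.Nonempty)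
    (h : 2 * m * #S ≤ degreeSum G S) :
    ∃ U N : Finset V, U ⊆ S ∧ N ⊆ S ∧ N.Nonempty ∧ Disjoint U N ∧
      (G.induce (U : Set V)).Connected ∧ ∀ v ∈ N, (∃ u ∈ U, G.Adj u v) ∧ m ≤ degreeIn G N v := by
  classical
  induction S using Finset.strongInduction with | H S ih =>
  obtain ⟨U, hUS, hUconn, hUsum, hdeg⟩ := exists_maximal_contraction hS h
  obtain hN | hN := (outerNeighbors G S U).eq_empty_or_nonempty
  · have hsum : 2 * m * (#(S \ U) + 1) ≤ degreeSum G (S \ U) := by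
      simpa [contractedDegreeSum, hN] using hUsum
    have hne : (S \ U).Nonempty := by
      rw [nonempty_iff_ne_empty]
      intro hempty
      simp [hempty, degreeSum, hm.ne'] at hsum
    have hUne : U.Nonempty := by simpa using Set.nonempty_coe_sort.1 hUconn.nonempty
    obtain ⟨U', N, hU', hN, hrest⟩ := ih _ (sdiff_ssubset hUS hUne) hne
      ((Nat.mul_le_mul_left _ (Nat.le_succ _)).trans hsum)
    exact ⟨U', N, hU'.trans sdiff_subset, hN.trans sdiff_subset, hrest⟩
  · have hNR : outerNeighbors G S U ⊆ S \ U := filter_subset _ _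
    exact ⟨U, _, hUS, hNR.trans sdiff_subset, hN, disjoint_sdiff.mono_right hNR, hUconn,
      fun v hv => ⟨(mem_filter.1 hv).2, hdeg v hv⟩⟩

/-- Mader's theorem. -/
theorem HasCliqueMinorIn.of_dense {r : ℕ} (hS : S.Nonempty)
    (h : 2 * 2 ^ r * #S ≤ degreeSum G S) : HasCliqueMinorIn G S r := by
  induction r generalizing S with
  | zero => exact hasCliqueMinorIn_zero
  | succ r ih =>
    obtain ⟨U, N, hUS, hNS, hN, hUN, hU, hdeg⟩ :=
      exists_connected_dense_neighbors (by positivity) hS h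
    have hdense : 2 * 2 ^ r * #N ≤ degreeSum G N := by
      calc 2 * 2 ^ r * #N = #N • 2 ^ (r + 1) := by rw [smul_eq_mul]; ring
        _ ≤ degreeSum G N := card_nsmul_le_sum _ _ _ fun v hv => (hdeg v hv).2
    exact ((ih hN hdense).cone hU (mod_cast hUN) fun v hv => (hdeg v hv).1).mono
      (Set.union_subset (mod_cast hUS) (mod_cast hNS))

/-- `G` is `d`-degenerate: every finite set of vertices induces a subgraph with a vertex of degree
at most `d`. -/
def IsDegenerate (G : SimpleGraph V) (d : ℕ) : Prop :=
  ∀ S : Finset V, S.Nonempty → ∃ v ∈ S, degreeIn G S v ≤ d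

theorem isDegenerate_of_not_hasCliqueMinor {r : ℕ} (h : ¬ HasCliqueMinor G r) :
    IsDegenerate G (2 * 2 ^ r) := by
  intro S hS
  by_contra! hdeg
  refine h (HasCliqueMinorIn.of_dense hS ?_).hasCliqueMinor
  rw [mul_comm, ← smul_eq_mul]
  exact card_nsmul_le_sum _ _ _ fun v hv => (hdeg v hv).le

end Density

section StarForests

open SimpleGraph

variable {V : Type*} {F G : SimpleGraph V}

/-- `p` sends each end of an edge of `F` to the center of the star containing the edge. -/
def IsCenterMap (F : SimpleGraph V) (p : V → V) : Prop :=
  ∀ u v, F.Adj u v → p u = p v ∧ (p u = u ∨ p u = v)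

theorem IsCenterMap.isAcyclic {p : V → V} (hp : IsCenterMap F p) : F.IsAcyclic := by
  have hleaf {u v : V} (huv : F.Adj u v) (hpu : p u = v) :
      ¬ (F.deleteEdges {s(u, v)}).Reachable u v := by
    rintro ⟨q⟩
    cases q with
    | nil => exact huv.ne rfl
    | @cons _ w _ huw q =>
      obtain ⟨hadj, hne⟩ := deleteEdges_adj.1 huw
      obtain hu | hw := (hp u w hadj).2
      · exact huv.ne (hu.symm.trans hpu)
      · exact hne (by rw [← hw, hpu]; rfl)
  refine isAcyclic_iff_forall_isBridge.2 fun e he => ?_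
  induction e with | h u v =>
  obtain ⟨heq, hu | hv⟩ := hp u v he
  · rw [Sym2.eq_swap]
    exact isBridge_iff.2 (hleaf he.symm (heq.symm.trans hu))
  · exact isBridge_iff.2 (hleaf he hv)

theorem IsCenterMap.eq_of_reachable {p : V → V} (hp : IsCenterMap F p) {u v : V}
    (huv : F.Reachable u v) : p u = p v := by
  obtain ⟨q⟩ := huv
  induction q with
  | nil => rfl
  | cons huw _ ih => exact (hp _ _ huw).1.trans ih

theorem IsCenterMap.exists_walk_length_le_one {p : V → V} (hp : IsCenterMap F p) {u v : V}
    (huv : F.Reachable u v) (hne : u ≠ v) : ∃ q : F.Walk u (p u), q.length ≤ 1 := by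
  obtain ⟨_ | ⟨huw, _⟩⟩ := huv
  · exact absurd rfl hne
  · obtain hu | hw := (hp _ _ huw).2
    · rw [hu]
      exact ⟨.nil, by simp⟩
    · rw [hw]
      exact ⟨huw.toWalk, by simp⟩

theorem IsCenterMap.isStarForest {p : V → V} (hp : IsCenterMap F p) : IsStarForest F := by
  refine ⟨hp.isAcyclic, fun u v huv => ?_⟩
  obtain rfl | hne := eq_or_ne u v
  · simp
  obtain ⟨q, hq⟩ := hp.exists_walk_length_le_one huv hne
  obtain ⟨q', hq'⟩ : ∃ q' : F.Walk v (p u), q'.length ≤ 1 :=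
    hp.eq_of_reachable huv ▸ hp.exists_walk_length_le_one huv.symm hne.symm
  calc F.dist u v ≤ (q.append q'.reverse).length := dist_le _
    _ ≤ 2 := by
      rw [Walk.length_append, Walk.length_reverse]
      omega

theorem hasStarDecomposition_of_exists_center {m : ℕ} (f : Fin m → V → V)
    (hf : ∀ u v, G.Adj u v → ∃ i, f i u = f i v ∧ (f i u = u ∨ f i u = v)) :
    HasStarDecomposition G m := by
  have hcls (e : Sym2 V) (he : e ∈ G.edgeSet) :
      ∃ i, ∀ u v, e = s(u, v) → f i u = f i v ∧ (f i u = u ∨ f i u = v) := by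
    induction e with | h a b =>
    obtain ⟨i, heq, hab⟩ := hf a b he
    refine ⟨i, fun u v huv => ?_⟩
    obtain ⟨rfl, rfl⟩ | ⟨rfl, rfl⟩ := Sym2.eq_iff.1 huv
    exacts [⟨heq, hab⟩, ⟨heq.symm, heq ▸ hab.symm⟩]
  choose cls hcls using hcls
  have hedge (i : Fin m) : (fromEdgeSet {e | ∃ he, cls e he = i}).edgeSet =
      {e | ∃ he, cls e he = i} := by
    rw [edgeSet_fromEdgeSet, sdiff_eq_left, Set.disjoint_left]
    rintro e ⟨he, -⟩
    exact G.not_isDiag_of_mem_edgeSet he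
  refine ⟨fun i => fromEdgeSet {e | ∃ he, cls e he = i}, fun i => ?_, fun i j hij => ?_, ?_⟩
  · refine IsCenterMap.isStarForest (p := f i) fun u v huv => ?_
    obtain ⟨⟨he, rfl⟩, -⟩ := (fromEdgeSet_adj _).1 huv
    exact hcls _ he u v rfl
  · rw [hedge, hedge, Set.disjoint_left]
    rintro e ⟨_, hi⟩ ⟨_, hj⟩
    exact hij (hi.symm.trans hj)
  · ext e
    simp [hedge]

open Finset in
theorem IsDegenerate.exists_coloring_orientation {d : ℕ} (h : IsDegenerate G d) (S : Finset V) :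
    ∃ (c : V → Fin (d + 1)) (p : Fin d → V → V), ∀ u ∈ S, ∀ v ∈ S, G.Adj u v →
      c u ≠ c v ∧ ∃ i, p i u = v ∨ p i v = u := by
  classical
  induction S using Finset.strongInduction with | H S ih =>
  obtain rfl | hS := S.eq_empty_or_nonempty
  · exact ⟨fun _ => 0, fun _ => id, by simp⟩
  obtain ⟨v, hv, hdeg⟩ := h S hS
  obtain ⟨c, p, hcp⟩ := ih _ (erase_ssubset hv)
  let N : Finset V := {w ∈ S | G.Adj v w}
  have hN : #N ≤ d := hdeg
  obtain ⟨a, -, ha⟩ : ∃ a ∈ univ, a ∉ N.image c := exists_mem_notMem_of_card_lt_card <|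
    calc #(N.image c) ≤ #N := card_image_le
      _ < #univ := by simpa [Nat.lt_succ_iff] using hN
  obtain ⟨g⟩ : Nonempty (N ↪ Fin d) := Function.Embedding.nonempty_of_card_le (by simpa using hN)
  have hnew {w : V} (hw : w ∈ S) (hvw : G.Adj v w) :
      a ≠ c w ∧ ∃ i, Function.extend g Subtype.val (fun _ => v) i = w := by
    have hwN : w ∈ N := mem_filter.2 ⟨hw, hvw⟩
    exact ⟨fun hac => ha (hac ▸ mem_image_of_mem c hwN),
      g ⟨w, hwN⟩, g.injective.extend_apply _ _ _⟩
  refine ⟨Function.update c v a,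
    fun i => Function.update (p i) v (Function.extend g Subtype.val (fun _ => v) i), ?_⟩
  intro u hu w hw huw
  obtain rfl | huv := eq_or_ne u v
  · obtain ⟨hne, i, hi⟩ := hnew hw huw
    exact ⟨by simpa [huw.ne'] using hne, i, .inl (by simpa using hi)⟩
  obtain rfl | hwv := eq_or_ne w v
  · obtain ⟨hne, i, hi⟩ := hnew hu huw.symm
    exact ⟨by simpa [huv] using hne.symm, i, .inr (by simpa using hi)⟩
  · simpa [huv, hwv] using hcp u (mem_erase.2 ⟨huv, hu⟩) w (mem_erase.2 ⟨hwv, hw⟩) huw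

/-- The star forests are indexed by an out-neighbor slot `i` and a color `k`: the vertices of
color `k` are attached to their `i`-th out-neighbor, whose color is different. -/
theorem IsDegenerate.hasStarDecomposition [Finite V] {d : ℕ} (h : IsDegenerate G d) :
    HasStarDecomposition G (d * (d + 1)) := by
  have := Fintype.ofFinite V
  obtain ⟨c, p, hcp⟩ := h.exists_coloring_orientation Finset.univ
  let f (j : Fin d × Fin (d + 1)) (u : V) : V := if c u = j.2 then p j.1 u else u
  have hf {u v : V} {i : Fin d} (huv : G.Adj u v) (hi : p i u = v) :
      f (i, c u) u = v ∧ f (i, c u) v = v := by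
    simp [f, hi, (hcp u (Finset.mem_univ u) v (Finset.mem_univ v) huv).1.symm]
  refine hasStarDecomposition_of_exists_center (fun j => f (finProdFinEquiv.symm j))
    fun u v huv => ?_
  obtain ⟨-, i, hi | hi⟩ := hcp u (Finset.mem_univ u) v (Finset.mem_univ v) huv
  · obtain ⟨hu, hv⟩ := hf huv hi
    exact ⟨finProdFinEquiv (i, c u), by simp [hu, hv]⟩
  · obtain ⟨hv, hu⟩ := hf huv.symm hi
    exact ⟨finProdFinEquiv (i, c v), by simp [hu, hv]⟩

theorem starArboricity_le_of_not_hasCliqueMinor [Finite V] {s : ℕ} (h : ¬ HasCliqueMinor G s) :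
    starArboricity G ≤ 2 * 2 ^ s * (2 * 2 ^ s + 1) :=
  Nat.sInf_le (isDegenerate_of_not_hasCliqueMinor h).hasStarDecomposition

theorem bddAbove_starArboricityValues (s : ℕ) : BddAbove (starArboricityValues s) := by
  refine ⟨2 * 2 ^ s * (2 * 2 ^ s + 1), ?_⟩
  rintro _ ⟨n, G, hG, rfl⟩
  exact starArboricity_le_of_not_hasCliqueMinor hG

theorem hasStarDecomposition_starArboricity [Finite V] (G : SimpleGraph V) :
    HasStarDecomposition G (starArboricity G) := by
  have hG : ¬ HasCliqueMinor G (Nat.card V + 1) := fun h => (Nat.lt_succ_self _).not_ge h.le_card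
  exact Nat.sInf_mem (s := {m | HasStarDecomposition G m})
    ⟨_, (isDegenerate_of_not_hasCliqueMinor hG).hasStarDecomposition⟩

theorem one_le_starArboricity [Finite V] (hG : G.edgeSet.Nonempty) : 1 ≤ starArboricity G := by
  obtain ⟨F, -, -, hF⟩ := hasStarDecomposition_starArboricity G
  rw [← hF] at hG
  obtain ⟨_, he⟩ := hG
  exact Fin.pos (Set.mem_iUnion.1 he).choose

theorem one_le_maxStarArboricity {s : ℕ} (hs : 3 ≤ s) : 1 ≤ maxStarArboricity s := by
  have hminor : ¬ HasCliqueMinor (⊤ : SimpleGraph (Fin 2)) s := fun h => by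
    have hcard := h.le_card
    rw [Nat.card_fin] at hcard
    omega
  have hedge : (⊤ : SimpleGraph (Fin 2)).edgeSet.Nonempty := ⟨s(0, 1), by simp⟩
  exact (one_le_starArboricity hedge).trans
    (le_csSup (bddAbove_starArboricityValues s) ⟨2, ⊤, hminor, rfl⟩)

end StarForests

theorem theorem1p5_general (t : ℕ) :
    BddAbove (starArboricityValues (t - 1)) ∧
    ∃ k : ℕ, k ≤ min 8 (7 * maxStarArboricity (t - 1) + 1) ∧
      ∀ (V : Type*) [Finite V] (G T : SimpleGraph V),
        (t ≤ 3 → ¬ HasCliqueMinor G t) → IsSpanningForest G T →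
        ∃ φ : ↥(G.edgeSet \ T.edgeSet) → Fin k,
          ∀ f ∈ T.edgeSet, ¬ G.IsBridge f →
            ∃ i : Fin k,
              Odd (Set.ncard {e : ↥(G.edgeSet \ T.edgeSet) |
                (e : Sym2 V) ∈ fundamentalCut G T f ∧ φ e = i}) := by
  refine ⟨bddAbove_starArboricityValues _, ?_⟩
  obtain ht | ht := le_or_gt t 3
  · refine ⟨1, by omega, fun V _ G T hG hT => ⟨fun _ => 0, fun f hf hbridge => ?_⟩⟩
    induction f with | h u v =>
    have hadj : G.Adj u v := hT.prop.1 hf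
    exact absurd ((hasCliqueMinor_three_of_not_isBridge hadj hbridge).anti ht) (hG ht)
  · have hstar : 1 ≤ maxStarArboricity (t - 1) := one_le_maxStarArboricity (by omega)
    exact ⟨8, by omega, fun V _ G T _ hT => exists_odd_coloring hT⟩

theorem theorem1p5 (t : ℕ) :
    BddAbove (starArboricityValues (t - 1)) ∧
    ∃ k : ℕ, k ≤ 16 * maxStarArboricity (t - 1) + 1 ∧
      ∀ (V : Type*) [Finite V] (G T : SimpleGraph V),
        ¬ HasCliqueMinor G t → IsSpanningForest G T →
        ∃ φ : ↥(G.edgeSet \ T.edgeSet) → Fin k,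
          ∀ f ∈ T.edgeSet, ¬ G.IsBridge f →
            ∃ i : Fin k,
              Odd (Set.ncard {e : ↥(G.edgeSet \ T.edgeSet) |
                (e : Sym2 V) ∈ fundamentalCut G T f ∧ φ e = i}) := by
  obtain ⟨hbdd, k, hk, h⟩ := theorem1p5_general t
  exact ⟨hbdd, k, by omega, fun V _ G T hG => h V G T fun _ => hG⟩
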